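/- Let $\mathcal{E}$ be an exact category in the sense of Quillen with enough projectives and enough injectives; let $\mathcal{P}$ and $\mathcal{I}$ denote the full subcategories of all projective and of all injective objects of $\mathcal{E}$. Let $\mathcal{M}$ be a full additive subcategory of $\mathcal{E}$ and let $k \geq 1$ be an integer. Let $\operatorname{cogen}^k_{\mathcal{E}}(\mathcal{M})$ be the full subcategory of all objects $X$ of $\mathcal{E}$ for which there is an exact sequence $0 \to X \to M_0 \to \cdots \to M_k \to Z \to 0$ in $\mathcal{E}$ (that is, a sequence spliced from conflations) with all $M_i \in \mathcal{M}$ such that for every $M \in \mathcal{M}$ the sequence of abelian groups $$\operatorname{Hom}(M_k,M) \to \cdots \to \operatorname{Hom}(M_0,M) \to \operatorname{Hom}(X,M) \to 0$$ is exact. Dually, let $\operatorname{gen}_k^{\mathcal{E}}(\mathcal{M})$ be the full subcategory of all objects $X$ for which there is an exact sequence $0 \to Z \to M_k \to \cdots \to M_0 \to X \to 0$ in $\mathcal{E}$ with all $M_i \in \mathcal{M}$ such that for every $M \in \mathcal{M}$ the sequence $$\operatorname{Hom}(M,M_k) \to \cdots \to \operatorname{Hom}(M,M_0) \to \operatorname{Hom}(M,X)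 \to 0$$ is exact. A right (resp. left) $\mathcal{M}$-module is a contravariant (resp. covariant) additive functor from $\mathcal{M}$ to abelian groups; let $\operatorname{mod}_k\text{-}\mathcal{M}$ (resp. $\mathcal{M}\text{-}\operatorname{mod}_k$) be the category of those right (resp. left) $\mathcal{M}$-modules $F$ that admit an exact sequence $Q_k \to \cdots \to Q_0 \to F \to 0$ with all $Q_i$ finitely generated projective. Then the following two statements are equivalent: (1) $\mathcal{P} \subset \operatorname{cogen}^k_{\mathcal{E}}(\mathcal{M})$, and $\operatorname{Hom}_{\mathcal{E}}(-,I)|_{\mathcal{M}} \in \operatorname{mod}_k\text{-}\mathcal{M}$ for every $I \in \mathcal{I}$. (2) $\mathcal{I} \subset \operatorname{gen}_k^{\mathcal{E}}(\mathcal{M})$, and $\operatorname{Hom}_{\mathcal{E}}(P,-)|_{\mathcal{M}} \in \mathcal{M}\text{-}\operatorname{mod}_k$ for every $P \in \mathcal{P}$. -/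

import Mathlib

open CategoryTheory CategoryTheory.Limits

universe v u

namespace SymPrinciple

section ExactCategories

variable {C : Type u} [Category.{v} C] [Preadditive C]

/-- An exact structure (in the sense of Quillen) on an additive category: a class of
kernel-cokernel pairs `X → Y → Z`, called conflations, closed under isomorphism. In a conflation
the first morphism is called an inflation and the second one a deflation. Identities are inflations
and deflations, both classes are closed under composition, inflations admit pushouts along
arbitrary morphisms and these are inflations, deflations admit pullbacks along arbitrary morphisms
and these are deflations. -/
structure ExactStructure (C : Type u) [Category.{v} C] [Preadditive C] where
  /-- the class of conflations -/
  conflation : ObjectProperty (ShortComplex C)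
  conflation_of_iso : ∀ {S T : ShortComplex C}, (S ≅ T) → conflation S → conflation T
  isKernel : ∀ {S : ShortComplex C}, conflation S →
    Nonempty (IsLimit (KernelFork.ofι S.f S.zero))
  isCokernel : ∀ {S : ShortComplex C}, conflation S →
    Nonempty (IsColimit (CokernelCofork.ofπ S.g S.zero))
  /-- the class of inflations -/
  inflation : MorphismProperty C
  inflation_iff : ∀ {X Y : C} (f : X ⟶ Y),
    inflation f ↔ ∃ (Z : C) (g : Y ⟶ Z) (w : f ≫ g = 0), conflation (ShortComplex.mk f g w)
  /-- the class of deflations -/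
  deflation : MorphismProperty C
  deflation_iff : ∀ {Y Z : C} (g : Y ⟶ Z),
    deflation g ↔ ∃ (X : C) (f : X ⟶ Y) (w : f ≫ g = 0), conflation (ShortComplex.mk f g w)
  id_inflation : ∀ X : C, inflation (𝟙 X)
  id_deflation : ∀ X : C, deflation (𝟙 X)
  comp_inflation : ∀ {X Y Z : C} (f : X ⟶ Y) (g : Y ⟶ Z),
    inflation f → inflation g → inflation (f ≫ g)
  comp_deflation : ∀ {X Y Z : C} (f : X ⟶ Y) (g : Y ⟶ Z),
    deflation f → deflation g → deflation (f ≫ g)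
  pushout_inflation : ∀ {X Y X' : C} (i : X ⟶ Y) (f : X ⟶ X'), inflation i →
    ∃ (Y' : C) (f' : Y ⟶ Y') (i' : X' ⟶ Y'), IsPushout i f f' i' ∧ inflation i'
  pullback_deflation : ∀ {Y Z Z' : C} (p : Y ⟶ Z) (f : Z' ⟶ Z), deflation p →
    ∃ (Y' : C) (f' : Y' ⟶ Y) (p' : Y' ⟶ Z'), IsPullback f' p' p f ∧ deflation p'

namespace ExactStructure

variable (E : ExactStructure C)

/-- `0 → X → Y → Z → 0` is an admissible short exact sequence. -/
def IsShortExact {X Y Z : C} (f : X ⟶ Y) (g : Y ⟶ Z) : Prop :=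
  ∃ w : f ≫ g = 0, E.conflation (ShortComplex.mk f g w)

/-- Projective objects of the exact category: they lift against deflations. -/
def projectives : ObjectProperty C := fun P =>
  ∀ ⦃Y Z : C⦄ (p : Y ⟶ Z), E.deflation p → ∀ f : P ⟶ Z, ∃ g : P ⟶ Y, g ≫ p = f

/-- Injective objects of the exact category: they extend along inflations. -/
def injectives : ObjectProperty C := fun I =>
  ∀ ⦃X Y : C⦄ (i : X ⟶ Y), E.inflation i → ∀ f : X ⟶ I, ∃ g : Y ⟶ I, i ≫ g = f

/-- Every object is the target of a deflation from a projective object. -/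
def EnoughProjectives : Prop :=
  ∀ X : C, ∃ (P : C) (p : P ⟶ X), E.projectives P ∧ E.deflation p

/-- Every object is the source of an inflation into an injective object. -/
def EnoughInjectives : Prop :=
  ∀ X : C, ∃ (I : C) (i : X ⟶ I), E.injectives I ∧ E.inflation i

/-- An exact sequence `0 → Z → N k → ⋯ → N 1 → N 0 → X → 0` in the exact category, that is, a
sequence spliced from the conflations `K 0 → N 0 → X` and `K (i + 1) → N (i + 1) → K i`, `i < k`,
with `Z = K k`. Only the terms with index at most `k` matter. -/
structure LeftSequence (k : ℕ) (X : C) where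
  N : ℕ → C
  K : ℕ → C
  ε : N 0 ⟶ X
  d : ∀ i, N (i + 1) ⟶ N i
  ι : ∀ i, K i ⟶ N i
  π : ∀ i, N (i + 1) ⟶ K i
  fac : ∀ i, i < k → π i ≫ ι i = d i
  exact_zero : E.IsShortExact (ι 0) ε
  exact_succ : ∀ i, i < k → E.IsShortExact (ι (i + 1)) (π i)

/-- An exact sequence `0 → X → N 0 → N 1 → ⋯ → N k → Z → 0` in the exact category, that is, a
sequence spliced from the conflations `X → N 0 → K 0` and `K i → N (i + 1) → K (i + 1)`, `i < k`,
with `Z = K k`. Only the terms with index at most `k` matter. -/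
structure RightSequence (k : ℕ) (X : C) where
  N : ℕ → C
  K : ℕ → C
  η : X ⟶ N 0
  d : ∀ i, N i ⟶ N (i + 1)
  π : ∀ i, N i ⟶ K i
  ι : ∀ i, K i ⟶ N (i + 1)
  fac : ∀ i, i < k → π i ≫ ι i = d i
  exact_zero : E.IsShortExact η (π 0)
  exact_succ : ∀ i, i < k → E.IsShortExact (ι i) (π (i + 1))

/-- `Hom(T, N k) → ⋯ → Hom(T, N 0) → Hom(T, X) → 0` is exact (there is no condition at
`Hom(T, N k)`). -/
structure LeftSequence.HomExact {E : ExactStructure C} {k : ℕ} {X : C} (S : E.LeftSequence k X)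
    (T : C) : Prop where
  surjective : Function.Surjective (fun g : T ⟶ S.N 0 => g ≫ S.ε)
  exact_zero : 0 < k →
    Function.Exact (fun g : T ⟶ S.N 1 => g ≫ S.d 0) (fun g : T ⟶ S.N 0 => g ≫ S.ε)
  exact_succ : ∀ i, i + 1 < k →
    Function.Exact (fun g : T ⟶ S.N (i + 2) => g ≫ S.d (i + 1))
      (fun g : T ⟶ S.N (i + 1) => g ≫ S.d i)

/-- `Hom(N k, T) → ⋯ → Hom(N 0, T) → Hom(X, T) → 0` is exact (there is no condition at
`Hom(N k, T)`). -/
structure RightSequence.HomExact {E : ExactStructure C} {k : ℕ} {X : C} (S : E.RightSequence k X)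
    (T : C) : Prop where
  surjective : Function.Surjective (fun g : S.N 0 ⟶ T => S.η ≫ g)
  exact_zero : 0 < k →
    Function.Exact (fun g : S.N 1 ⟶ T => S.d 0 ≫ g) (fun g : S.N 0 ⟶ T => S.η ≫ g)
  exact_succ : ∀ i, i + 1 < k →
    Function.Exact (fun g : S.N (i + 2) ⟶ T => S.d (i + 1) ≫ g)
      (fun g : S.N (i + 1) ⟶ T => S.d i ≫ g)

/-- The full subcategory `gen_k(M)`. -/
def gen (M : ObjectProperty C) (k : ℕ) : ObjectProperty C := fun X =>
  ∃ S : E.LeftSequence k X, (∀ i, i ≤ k → M (S.N i)) ∧ ∀ T, M T → S.HomExact T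

/-- The full subcategory `cogen^k(M)`. -/
def cogen (M : ObjectProperty C) (k : ℕ) : ObjectProperty C := fun X =>
  ∃ S : E.RightSequence k X, (∀ i, i ≤ k → M (S.N i)) ∧ ∀ T, M T → S.HomExact T

end ExactStructure

end ExactCategories

section Modules

variable {A : Type u} [Category.{v} A] [Preadditive A]

/-- A (left) `A`-module `F`, that is, an additive functor from `A` to abelian groups, is finitely
generated: finitely many elements `x i ∈ F (a i)` generate it. -/
def IsFinGen (F : A ⥤+ AddCommGrpCat.{v}) : Prop :=
  ∃ (n : ℕ) (a : Fin n → A) (x : ∀ i, F.obj.obj (a i)),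
    ∀ (b : A) (y : F.obj.obj b), ∃ f : ∀ i, a i ⟶ b, y = ∑ i, F.obj.map (f i) (x i)

/-- A `k`-presentation `P k → ⋯ → P 1 → P 0 → F → 0` of an `A`-module `F` by finitely generated
projective `A`-modules; exactness of sequences of modules is exactness at each object of `A`, and
nothing is required at `P k`. Only the terms with index at most `k` matter. -/
structure ModulePresentation (k : ℕ) (F : A ⥤+ AddCommGrpCat.{v}) where
  P : ℕ → (A ⥤+ AddCommGrpCat.{v})
  ε : P 0 ⟶ F
  d : ∀ i, P (i + 1) ⟶ P i
  finGen : ∀ i, i ≤ k → IsFinGen (P i)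
  projective : ∀ i, i ≤ k → Projective (P i)
  surjective : ∀ a : A, Function.Surjective (ε.hom.app a)
  exact_zero : 0 < k → ∀ a : A, Function.Exact ((d 0).hom.app a) (ε.hom.app a)
  exact_succ : ∀ i, i + 1 < k → ∀ a : A,
    Function.Exact ((d (i + 1)).hom.app a) ((d i).hom.app a)

/-- The category `A-mod_k` of the left `A`-modules admitting a `k`-presentation by finitely
generated projectives. For `A = Mᵒᵖ` this is the category `mod_k-M` of right `M`-modules. -/
def modK (A : Type u) [Category.{v} A] [Preadditive A] (k : ℕ) :
    ObjectProperty (A ⥤+ AddCommGrpCat.{v}) := fun F =>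
  Nonempty (ModulePresentation k F)

variable {C : Type u} [Category.{v} C] [Preadditive C] (M : ObjectProperty C)

/-- The right `M`-module `Φ(X) = Hom(-, X)|_M`. -/
noncomputable def homTo (X : C) : M.FullSubcategoryᵒᵖ ⥤+ AddCommGrpCat.{v} :=
  AdditiveFunctor.of (M.ι.op ⋙ preadditiveYoneda.obj X)

/-- The left `M`-module `Ψ(X) = Hom(X, -)|_M`. -/
noncomputable def homFrom (X : C) : M.FullSubcategory ⥤+ AddCommGrpCat.{v} :=
  AdditiveFunctor.of (M.ι ⋙ preadditiveCoyoneda.obj (Opposite.op X))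

end Modules

end SymPrinciple

/-! Half of each implication is free: a sequence witnessing `cogen` for `P`, read through `Hom(-,
M)`, is a presentation of `homFrom M P`, and dually for `gen`. By passage to the opposite category
it remains to show that (1) puts every injective `I` in `gen`.

Membership in `gen` amounts to `k + 1` successive conflations `K → N → X` whose deflation is a right
`M`-approximation (`gen_iff_isGen`). Finite generation of `homTo M X` gives an approximation `g : N
⟶ X`, and Schanuel's lemma `modK.kernel` makes `homTo M K` presentable one step shorter, so the
module side of the induction continues. What is missing is that `g` need not be a deflation.

This is repaired by the invariant `FactorsThrough`: maps from objects of `cogen^j` to the `j`-th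
syzygy of `I` factor through `M`. Injectivity gives `j = 0`, and `FactorsThrough.succ` passes from
`X` to `K`. Since projectives lie in `cogen^j`, a deflation `P ⟶ X` factors through `g`, and also
through an inflation `P ⟶ N₀` with `N₀` in `M`. Then `(g, 0) : N ⊕ N₀ ⟶ X` is a deflation
(`deflation_fst_comp`) and still an approximation. -/

namespace SymPrinciple

/-! ### Duality and elementary properties of conflations. -/

namespace ExactStructure

variable {C : Type u} [Category.{v} C] [Preadditive C] (E : ExactStructure C)

/-- The opposite of an exact structure. -/
def op : ExactStructure Cᵒᵖ where
  conflation S := E.conflation S.unop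
  conflation_of_iso e h :=
    E.conflation_of_iso ((ShortComplex.unopFunctor C).mapIso e).unop.symm h
  isKernel h := ⟨CokernelCofork.IsColimit.ofπOp _ _ (E.isCokernel h).some⟩
  isCokernel h := ⟨KernelFork.IsLimit.ofιOp _ _ (E.isKernel h).some⟩
  inflation := E.deflation.op
  inflation_iff f := by
    refine (E.deflation_iff f.unop).trans ⟨?_, ?_⟩
    · rintro ⟨X, g, w, h⟩
      exact ⟨Opposite.op X, g.op, Quiver.Hom.unop_inj w, h⟩
    · rintro ⟨X, g, w, h⟩
      exact ⟨X.unop, g.unop, Quiver.Hom.op_inj w, h⟩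
  deflation := E.inflation.op
  deflation_iff f := by
    refine (E.inflation_iff f.unop).trans ⟨?_, ?_⟩
    · rintro ⟨X, g, w, h⟩
      exact ⟨Opposite.op X, g.op, Quiver.Hom.unop_inj w, h⟩
    · rintro ⟨X, g, w, h⟩
      exact ⟨X.unop, g.unop, Quiver.Hom.op_inj w, h⟩
  id_inflation X := E.id_deflation X.unop
  id_deflation X := E.id_inflation X.unop
  comp_inflation f g hf hg := E.comp_deflation g.unop f.unop hg hf
  comp_deflation f g hf hg := E.comp_inflation g.unop f.unop hg hf
  pushout_inflation i f hi := by
    obtain ⟨Y', f', p', h, hp⟩ := E.pullback_deflation i.unop f.unop hi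
    exact ⟨Opposite.op Y', f'.op, p'.op, h.op.flip, hp⟩
  pullback_deflation p f hp := by
    obtain ⟨Y', f', i', h, hi⟩ := E.pushout_inflation p.unop f.unop hp
    exact ⟨Opposite.op Y', f'.op, i'.op, h.op.flip, hi⟩

variable {E}

lemma IsShortExact.op {X Y Z : C} {f : X ⟶ Y} {g : Y ⟶ Z} (h : E.IsShortExact f g) :
    E.op.IsShortExact g.op f.op :=
  ⟨by rw [← op_comp, h.1, op_zero], h.2⟩

lemma IsShortExact.unop {X Y Z : Cᵒᵖ} {f : X ⟶ Y} {g : Y ⟶ Z} (h : E.op.IsShortExact f g) :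
    E.IsShortExact g.unop f.unop :=
  ⟨by rw [← unop_comp, h.1, unop_zero], h.2⟩

lemma projectives.op {X : C} (h : E.projectives X) : E.op.injectives (Opposite.op X) := by
  intro Y Z i hi f
  obtain ⟨g, hg⟩ := h i.unop hi f.unop
  exact ⟨g.op, Quiver.Hom.unop_inj hg⟩

lemma injectives.op {X : C} (h : E.injectives X) : E.op.projectives (Opposite.op X) := by
  intro Y Z i hi f
  obtain ⟨g, hg⟩ := h i.unop hi f.unop
  exact ⟨g.op, Quiver.Hom.unop_inj hg⟩

lemma projectives_unop {X : Cᵒᵖ} (h : E.op.projectives X) : E.injectives X.unop := by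
  intro Y Z i hi f
  obtain ⟨g, hg⟩ := h i.op hi f.op
  exact ⟨g.unop, Quiver.Hom.op_inj hg⟩

lemma EnoughInjectives.op (h : E.EnoughInjectives) : E.op.EnoughProjectives := by
  intro X
  obtain ⟨I, i, hI, hi⟩ := h X.unop
  exact ⟨Opposite.op I, i.op, hI.op, hi⟩

namespace IsShortExact

variable {X Y Z : C} {f : X ⟶ Y} {g : Y ⟶ Z}

lemma zero (h : E.IsShortExact f g) : f ≫ g = 0 := h.1

lemma inflation (h : E.IsShortExact f g) : E.inflation f := (E.inflation_iff f).2 ⟨_, g, h⟩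

lemma deflation (h : E.IsShortExact f g) : E.deflation g := (E.deflation_iff g).2 ⟨_, f, h⟩

lemma mono (h : E.IsShortExact f g) : Mono f :=
  Fork.IsLimit.mono (E.isKernel h.2).some

lemma epi (h : E.IsShortExact f g) : Epi g :=
  Cofork.IsColimit.epi (E.isCokernel h.2).some

lemma exists_lift (h : E.IsShortExact f g) {T : C} (t : T ⟶ Y) (ht : t ≫ g = 0) :
    ∃ s : T ⟶ X, s ≫ f = t :=
  ⟨_, ((KernelFork.IsLimit.lift' (E.isKernel h.2).some t ht)).2⟩

lemma exists_desc (h : E.IsShortExact f g) {T : C} (t : Y ⟶ T) (ht : f ≫ t = 0) :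
    ∃ s : Z ⟶ T, g ≫ s = t :=
  ⟨_, ((CokernelCofork.IsColimit.desc' (E.isCokernel h.2).some t ht)).2⟩

/-- Cokernels are unique up to isomorphism and conflations are closed under isomorphism; `Epi g'`
supplies the uniqueness that the existence condition `hg'` leaves out. -/
lemma of_isCokernel (h : E.IsShortExact f g) {Z' : C} {g' : Y ⟶ Z'} [Epi g'] (w : f ≫ g' = 0)
    (hg' : ∀ {T : C} (t : Y ⟶ T), f ≫ t = 0 → ∃ s : Z' ⟶ T, g' ≫ s = t) :
    E.IsShortExact f g' := by
  have := h.epi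
  obtain ⟨a, ha⟩ := h.exists_desc g' w
  obtain ⟨b, hb⟩ := hg' g h.zero
  let e : Z ≅ Z' :=
    { hom := a
      inv := b
      hom_inv_id := by rw [← cancel_epi g, reassoc_of% ha, hb, Category.comp_id]
      inv_hom_id := by rw [← cancel_epi g', reassoc_of% hb, ha, Category.comp_id] }
  exact ⟨w, E.conflation_of_iso (ShortComplex.isoMk (S₁ := ShortComplex.mk f g h.1)
    (Iso.refl _) (Iso.refl _) e
    (by simp) (by simp [e, ha])) h.2⟩

end IsShortExact

lemma deflation_of_isIso {X Y : C} (e : X ⟶ Y) [IsIso e] : E.deflation e := by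
  obtain ⟨K, f, h⟩ := (E.deflation_iff _).1 (E.id_deflation X)
  exact IsShortExact.deflation (f := f) ⟨by simpa using h.1, E.conflation_of_iso
    (ShortComplex.isoMk (S₁ := ShortComplex.mk f (𝟙 X) h.1)
      (Iso.refl _) (Iso.refl _) (asIso e) (by simp) (by simp)) h.2⟩

lemma deflation_of_isPullback {Y Z Z' Y' : C} {p : Y ⟶ Z} {f : Z' ⟶ Z} {f' : Y' ⟶ Y}
    {p' : Y' ⟶ Z'} (h : IsPullback f' p' p f) (hp : E.deflation p) : E.deflation p' := by
  obtain ⟨Y'', f'', p'', h', hp'⟩ := E.pullback_deflation p f hp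
  rw [← h.isoIsPullback_hom_snd _ _ h']
  exact E.comp_deflation _ _ (deflation_of_isIso _) hp'

lemma inflation_of_isPushout {X Y X' Y' : C} {i : X ⟶ Y} {f : X ⟶ X'} {f' : Y ⟶ Y'}
    {i' : X' ⟶ Y'} (h : IsPushout i f f' i') (hi : E.inflation i) : E.inflation i' :=
  deflation_of_isPullback (E := E.op) h.op.flip hi

/-- A deflation `q : Y ⟶ X` induces a deflation on the pushout of `Y` along an inflation
that is annihilated by `q`. -/
lemma deflation_of_isPushout {P N Y Y' X : C} {i : P ⟶ N} {j : P ⟶ Y} {i' : Y ⟶ Y'} {j' : N ⟶ Y'}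
    (sq : IsPushout j i i' j') (hi : E.inflation i) {q : Y ⟶ X} (hq : E.deflation q)
    (w : j ≫ q = 0) {q' : Y' ⟶ X} (h₁ : i' ≫ q' = q) (h₂ : j' ≫ q' = 0) : E.deflation q' := by
  obtain ⟨K, κ, hκ⟩ := (E.deflation_iff q).1 hq
  replace hκ : E.IsShortExact κ q := hκ
  have := hκ.epi
  have : Epi q' := epi_of_epi_fac h₁
  obtain ⟨j₀, rfl⟩ := hκ.exists_lift j w
  -- Push the kernel `K` of `q` out along `i`; by pasting, the induced `ν : K' ⟶ Y'` is a pushout of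
  -- `κ`, hence an inflation, and `q'` turns out to be its cokernel.
  obtain ⟨K', a, b, t, -⟩ := E.pushout_inflation i j₀ hi
  have sq' := IsPushout.of_left' sq t.flip
  set ν := t.flip.desc (κ ≫ i') j' (by simpa using sq.w)
  have hν : E.inflation ν := inflation_of_isPushout sq' hκ.inflation
  have haν : a ≫ ν = j' := t.flip.inr_desc _ _ _
  have hbν : b ≫ ν = κ ≫ i' := t.flip.inl_desc _ _ _
  obtain ⟨Z, g, hg⟩ := (E.inflation_iff ν).1 hν
  replace hg : E.IsShortExact ν g := hg
  refine (hg.of_isCokernel (g' := q') ?_ ?_).deflation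
  · apply t.flip.hom_ext
    · simp [reassoc_of% hbν, h₁, hκ.zero]
    · simp [reassoc_of% haν, h₂]
  · intro T s hs
    obtain ⟨r, hr⟩ := hκ.exists_desc (i' ≫ s) (by rw [← reassoc_of% hbν, hs, comp_zero])
    refine ⟨r, sq.hom_ext ?_ ?_⟩
    · rw [reassoc_of% h₁, hr]
    · rw [reassoc_of% h₂, zero_comp, ← haν, Category.assoc, hs, comp_zero]

/-! ### Deflations out of biproducts. -/

section Biproducts

variable [HasBinaryBiproducts C]

lemma deflation_biprod_snd (X Y : C) : E.deflation (biprod.snd : X ⊞ Y ⟶ Y) := by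
  -- The cokernel `Z` of the identity is a zero object, and `biprod.snd` is the pullback of the
  -- deflation `X ⟶ Z`.
  obtain ⟨Z, g, h⟩ := (E.inflation_iff _).1 (E.id_inflation X)
  replace h : E.IsShortExact (𝟙 X) g := h
  have := h.epi
  have hg : g = 0 := by simpa using h.zero
  have hZ : IsZero Z := by
    rw [IsZero.iff_id_eq_zero, ← cancel_epi g, hg]
    simp
  refine deflation_of_isPullback (p := g) (f' := biprod.fst) (f := 0) ?_ h.deflation
  refine ⟨⟨hZ.eq_of_tgt _ _⟩, ⟨PullbackCone.IsLimit.mk _ (fun s => biprod.lift s.fst s.snd)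
    (by simp) (by simp) fun s m h₁ h₂ => ?_⟩⟩
  ext <;> simp [h₁, h₂]

lemma deflation_biprod_desc {M P X : C} (g : M ⟶ X) {p : P ⟶ X} (hp : E.deflation p) :
    E.deflation (biprod.desc g p) := by
  have h₁ : E.deflation (biprod.map (𝟙 M) p) := by
    refine deflation_of_isPullback (f' := biprod.snd) (f := biprod.snd) ?_ hp
    refine ⟨⟨by simp⟩, ⟨PullbackCone.IsLimit.mk _
      (fun s => biprod.lift (s.snd ≫ biprod.fst) s.fst) (by simp) (fun s => ?_) fun s m h₁ h₂ => ?_⟩⟩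
    · ext <;> simp [s.condition]
    · ext
      · simp [← h₂]
      · simp [h₁]
  -- The shear by `g` exhibits `(g, p)` as `1 ⊕ p`, an automorphism and a projection, all
  -- deflations.
  let φ : M ⊞ X ≅ M ⊞ X :=
    { hom := biprod.desc (biprod.inl + g ≫ biprod.inr) biprod.inr
      inv := biprod.desc (biprod.inl - g ≫ biprod.inr) biprod.inr
      hom_inv_id := by ext <;> simp
      inv_hom_id := by ext <;> simp }
  have h₂ : biprod.desc g p = biprod.map (𝟙 M) p ≫ φ.hom ≫ biprod.snd := by
    ext <;> simp [φ]
  have := φ.isIso_hom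
  rw [h₂]
  exact E.comp_deflation _ _ h₁ (E.comp_deflation _ _ (deflation_of_isIso φ.hom)
    (deflation_biprod_snd _ _))

/-- If a deflation `P ⟶ X` factors as an inflation `P ⟶ N` followed by `N ⟶ M ⟶ X`, then
`M ⊞ N ⟶ M ⟶ X` is a deflation. -/
lemma deflation_fst_comp {M N P X : C} {b : BinaryBicone M N}
    (hb : b.fst ≫ b.inl + b.snd ≫ b.inr = 𝟙 b.pt)
    {i : P ⟶ N} (hi : E.inflation i) (f : N ⟶ M) (g : M ⟶ X) (h : E.deflation (i ≫ f ≫ g)) :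
    E.deflation (b.fst ≫ g) := by
  -- Replacing the summand `P` by `N` along `i` is a pushout, so `deflation_of_isPushout` applies
  -- once `(g, 0)` on `M ⊞ P` is a deflation.
  have sq : IsPushout (biprod.inr : P ⟶ M ⊞ P) i (biprod.desc b.inl (i ≫ b.inr)) b.inr := by
    refine ⟨⟨by simp⟩, ⟨PushoutCocone.IsColimit.mk _
      (fun s => b.fst ≫ biprod.inl ≫ s.inl + b.snd ≫ s.inr) (fun s => ?_) (fun s => ?_)
      fun s m h₁ h₂ => ?_⟩⟩
    · ext
      · simp
      · simp [s.condition]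
    · simp
    · rw [← h₁, ← h₂]
      simp only [biprod.inl_desc_assoc]
      rw [← Category.assoc, ← Category.assoc, ← Preadditive.add_comp, hb,
        Category.id_comp]
  have hq : E.deflation (biprod.desc g (0 : P ⟶ X)) := by
    -- The component on `P` factors through `g`, so a shear by `i ≫ f` carries `(g, i ≫ f ≫ g)` to
    -- `(g, 0)`.
    let φ : M ⊞ P ≅ M ⊞ P :=
      { hom := biprod.desc biprod.inl (biprod.inr - (i ≫ f) ≫ biprod.inl)
        inv := biprod.desc biprod.inl (biprod.inr + (i ≫ f) ≫ biprod.inl)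
        hom_inv_id := by ext <;> simp
        inv_hom_id := by ext <;> simp }
    have : biprod.desc g (0 : P ⟶ X) = φ.hom ≫ biprod.desc g (i ≫ f ≫ g) := by
      ext <;> simp [φ]
    rw [this]
    have := φ.isIso_hom
    exact E.comp_deflation _ _ (deflation_of_isIso φ.hom) (deflation_biprod_desc _ h)
  exact deflation_of_isPushout sq hi hq (by simp) (by ext <;> simp) (by simp)

end Biproducts

end ExactStructure

/-! ### Iterated approximations and factorization through `M`. -/

namespace ExactStructure

variable {C : Type u} [Category.{v} C] [Preadditive C] {E : ExactStructure C}
  {M : ObjectProperty C}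

/-- `K ⟶ N ⟶ X` is a conflation with `N` in `M` whose deflation is a right `M`-approximation. -/
structure IsRightApprox (E : ExactStructure C) (M : ObjectProperty C) {K N X : C}
    (κ : K ⟶ N) (p : N ⟶ X) : Prop where
  mem : M N
  exact : E.IsShortExact κ p
  lift : ∀ T, M T → ∀ f : T ⟶ X, ∃ g : T ⟶ N, g ≫ p = f

/-- `X ⟶ N ⟶ K` is a conflation with `N` in `M` whose inflation is a left `M`-approximation. -/
structure IsLeftApprox (E : ExactStructure C) (M : ObjectProperty C) {X N K : C}
    (i : X ⟶ N) (q : N ⟶ K) : Prop where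
  mem : M N
  exact : E.IsShortExact i q
  extend : ∀ T, M T → ∀ f : X ⟶ T, ∃ g : N ⟶ T, i ≫ g = f

/-- Objects resolved by `n + 1` successive right `M`-approximations. -/
def IsGen (E : ExactStructure C) (M : ObjectProperty C) : ℕ → ObjectProperty C
  | 0, X => ∃ (K N : C) (κ : K ⟶ N) (p : N ⟶ X), E.IsRightApprox M κ p
  | n + 1, X => ∃ (K N : C) (κ : K ⟶ N) (p : N ⟶ X), E.IsRightApprox M κ p ∧ IsGen E M n K

/-- Objects coresolved by `n + 1` successive left `M`-approximations. -/
def IsCogen (E : ExactStructure C) (M : ObjectProperty C) : ℕ → ObjectProperty C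
  | 0, X => ∃ (N K : C) (i : X ⟶ N) (q : N ⟶ K), E.IsLeftApprox M i q
  | n + 1, X => ∃ (N K : C) (i : X ⟶ N) (q : N ⟶ K), E.IsLeftApprox M i q ∧ IsCogen E M n K

lemma IsRightApprox.op {K N X : C} {κ : K ⟶ N} {p : N ⟶ X} (h : E.IsRightApprox M κ p) :
    E.op.IsLeftApprox M.op p.op κ.op where
  mem := h.mem
  exact := h.exact.op
  extend T hT f := by
    obtain ⟨g, hg⟩ := h.lift T.unop hT f.unop
    exact ⟨g.op, Quiver.Hom.unop_inj hg⟩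

lemma IsLeftApprox.op {X N K : C} {i : X ⟶ N} {q : N ⟶ K} (h : E.IsLeftApprox M i q) :
    E.op.IsRightApprox M.op q.op i.op where
  mem := h.mem
  exact := h.exact.op
  lift T hT f := by
    obtain ⟨g, hg⟩ := h.extend T.unop hT f.unop
    exact ⟨g.op, Quiver.Hom.unop_inj hg⟩

lemma IsRightApprox.unop {K N X : Cᵒᵖ} {κ : K ⟶ N} {p : N ⟶ X}
    (h : E.op.IsRightApprox M.op κ p) : E.IsLeftApprox M p.unop κ.unop where
  mem := h.mem
  exact := h.exact.unop
  extend T hT f := by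
    obtain ⟨g, hg⟩ := h.lift (Opposite.op T) hT f.op
    exact ⟨g.unop, Quiver.Hom.op_inj hg⟩

lemma IsGen.op {n : ℕ} {X : C} (h : E.IsGen M n X) : E.op.IsCogen M.op n (Opposite.op X) := by
  induction n generalizing X with
  | zero =>
    obtain ⟨K, N, κ, p, h⟩ := h
    exact ⟨_, _, _, _, h.op⟩
  | succ n ih =>
    obtain ⟨K, N, κ, p, h, hK⟩ := h
    exact ⟨_, _, _, _, h.op, ih hK⟩

lemma IsGen.unop {n : ℕ} {X : Cᵒᵖ} (h : E.op.IsGen M.op n X) : E.IsCogen M n X.unop := by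
  induction n generalizing X with
  | zero =>
    obtain ⟨K, N, κ, p, h⟩ := h
    exact ⟨_, _, _, _, h.unop⟩
  | succ n ih =>
    obtain ⟨K, N, κ, p, h, hK⟩ := h
    exact ⟨_, _, _, _, h.unop, ih hK⟩

lemma IsCogen.zero_of {n : ℕ} {X : C} (h : E.IsCogen M n X) : E.IsCogen M 0 X := by
  cases n with
  | zero => exact h
  | succ n =>
    obtain ⟨N, K, i, q, h, -⟩ := h
    exact ⟨N, K, i, q, h⟩

lemma IsCogen.of_add {j n : ℕ} {X : C} (h : E.IsCogen M (j + n) X) : E.IsCogen M j X := by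
  induction j generalizing X with
  | zero => exact h.zero_of
  | succ j ih =>
    rw [Nat.succ_add] at h
    obtain ⟨N, K, i, q, h, hK⟩ := h
    exact ⟨N, K, i, q, h, ih hK⟩

/-- Every morphism from an object of `IsCogen M n` to `X` factors through an object of `M`. -/
def FactorsThrough (E : ExactStructure C) (M : ObjectProperty C) (n : ℕ) (X : C) : Prop :=
  ∀ L, E.IsCogen M n L → ∀ f : L ⟶ X, ∃ (N : C) (a : L ⟶ N) (b : N ⟶ X), M N ∧ a ≫ b = f

lemma injectives.factorsThrough {I : C} (hI : E.injectives I) (n : ℕ) :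
    E.FactorsThrough M n I := by
  intro L hL f
  obtain ⟨N, K, i, q, h⟩ := hL.zero_of
  obtain ⟨g, hg⟩ := hI i h.exact.inflation f
  exact ⟨N, i, g, h.mem, hg⟩

/-- Extend `f ≫ κ` to `g : N₀ ⟶ N`. The map it induces on cokernels, `t : L' ⟶ X`, factors through
`M` and so lifts through `p`; subtracting this lift from `g` gives a map into `K` that still
restricts to `f`, because the correction vanishes on `L`. -/
lemma FactorsThrough.succ {n : ℕ} {K N X : C} {κ : K ⟶ N} {p : N ⟶ X}
    (hX : E.FactorsThrough M n X) (h : E.IsRightApprox M κ p) :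
    E.FactorsThrough M (n + 1) K := by
  rintro L ⟨N₀, L', i, q, hi, hL'⟩ f
  obtain ⟨g, hg⟩ := hi.extend N h.mem (f ≫ κ)
  obtain ⟨t, ht⟩ := hi.exact.exists_desc (g ≫ p) (by
    rw [reassoc_of% hg, h.exact.zero, comp_zero])
  obtain ⟨N₁, a, b, hN₁, rfl⟩ := hX L' hL' t
  obtain ⟨b', rfl⟩ := h.lift N₁ hN₁ b
  obtain ⟨s, hs⟩ := h.exact.exists_lift (g - q ≫ a ≫ b') (by
    simp only [Preadditive.sub_comp, Category.assoc, ht, sub_self])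
  have := h.exact.mono
  refine ⟨N₀, i, s, hi.mem, ?_⟩
  rw [← cancel_mono κ, Category.assoc, hs, Preadditive.comp_sub, hg,
    reassoc_of% hi.exact.zero, zero_comp, sub_zero]

/-- A right `M`-approximation `g : N ⟶ X`, not assumed to be a deflation, becomes one after
adding an object of `M` on which it vanishes. -/
lemma exists_isRightApprox [HasBinaryBiproducts C] (hP : E.EnoughProjectives)
    (hM : ∀ X Y, M X → M Y →
      ∃ b : BinaryBicone X Y, M b.pt ∧ b.fst ≫ b.inl + b.snd ≫ b.inr = 𝟙 b.pt)
    {n : ℕ} (hcogen : E.projectives ≤ E.IsCogen M n)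
    {X : C} (hX : E.FactorsThrough M n X) {N : C} (hN : M N) (g : N ⟶ X)
    (hg : ∀ T, M T → ∀ f : T ⟶ X, ∃ h : T ⟶ N, h ≫ g = f) :
    ∃ (K N' : C) (κ : K ⟶ N') (p : N' ⟶ X), E.IsRightApprox M κ p := by
  obtain ⟨P, p, hPproj, hp⟩ := hP X
  obtain ⟨N₀, L, i, q, hi⟩ := (hcogen P hPproj).zero_of
  obtain ⟨N₁, a, b, hN₁, rfl⟩ := hX P (hcogen P hPproj) p
  obtain ⟨b', rfl⟩ := hg N₁ hN₁ b
  obtain ⟨a', rfl⟩ := hi.extend N₁ hN₁ a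
  obtain ⟨B, hB, htot⟩ := hM N N₀ hN hi.mem
  -- At this point `p = i ≫ a' ≫ b' ≫ g`, with `i` an inflation into `N₀`.
  have hdefl := deflation_fst_comp htot hi.exact.inflation (a' ≫ b') g (by simpa using hp)
  obtain ⟨K, κ, hκ⟩ := (E.deflation_iff _).1 hdefl
  refine ⟨K, B.pt, κ, B.fst ≫ g, hB, hκ, fun T hT f => ?_⟩
  obtain ⟨h, rfl⟩ := hg T hT f
  exact ⟨h ≫ B.inl, by simp⟩

/-- Let `Q n X` express that `X` has `n + 1` successive `M`-approximations on the level of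
`Hom(M, -)`. Then these are realized by conflations. -/
lemma isGen_of_factorsThrough [HasBinaryBiproducts C] (hP : E.EnoughProjectives)
    (hM : ∀ X Y, M X → M Y →
      ∃ b : BinaryBicone X Y, M b.pt ∧ b.fst ≫ b.inl + b.snd ≫ b.inr = 𝟙 b.pt)
    (Q : ℕ → C → Prop)
    (hQ : ∀ n X, Q n X → ∃ (N : C) (g : N ⟶ X), M N ∧
      ∀ T, M T → ∀ f : T ⟶ X, ∃ h : T ⟶ N, h ≫ g = f)
    (hQsucc : ∀ n {K N X : C} (κ : K ⟶ N) (p : N ⟶ X), E.IsRightApprox M κ p →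
      Q (n + 1) X → Q n K)
    (n j : ℕ) (hcogen : E.projectives ≤ E.IsCogen M (j + n)) {X : C}
    (hX : E.FactorsThrough M j X) (hQX : Q n X) : E.IsGen M n X := by
  induction n generalizing j X with
  | zero =>
    obtain ⟨N, g, hN, hg⟩ := hQ _ _ hQX
    exact exists_isRightApprox hP hM (fun P h => (hcogen P h).of_add) hX hN g hg
  | succ n ih =>
    obtain ⟨N, g, hN, hg⟩ := hQ _ _ hQX
    obtain ⟨K, N', κ, p, h⟩ :=
      exists_isRightApprox hP hM (fun P h => (hcogen P h).of_add) hX hN g hg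
    -- Each syzygy trades one step of `n` for one of `j`, so `j + n` and the hypothesis on
    -- projectives stay fixed.
    exact ⟨K, N', κ, p, h, ih (j + 1) (by rwa [Nat.succ_add_eq_add_succ]) (hX.succ h)
      (hQsucc n κ p h hQX)⟩

end ExactStructure

/-! ### Spliced sequences as iterated approximations. -/

namespace ExactStructure

variable {C : Type u} [Category.{v} C] [Preadditive C] {E : ExactStructure C}
  {M : ObjectProperty C}

namespace LeftSequence

/-- The sequence consisting of one conflation. -/
def single {K N X : C} {κ : K ⟶ N} {p : N ⟶ X} (h : E.IsShortExact κ p) :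
    E.LeftSequence 0 X where
  N _ := N
  K _ := K
  ε := p
  d _ := 0
  ι _ := κ
  π _ := 0
  fac _ hi := absurd hi (Nat.not_lt_zero _)
  exact_zero := h
  exact_succ _ hi := absurd hi (Nat.not_lt_zero _)

/-- Splicing a conflation with a sequence ending in its kernel. -/
def cons {k : ℕ} {K N X : C} {κ : K ⟶ N} {p : N ⟶ X} (h : E.IsShortExact κ p)
    (S : E.LeftSequence k K) : E.LeftSequence (k + 1) X where
  N
    | 0 => N
    | i + 1 => S.N i
  K
    | 0 => K
    | i + 1 => S.K i
  ε := p
  d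
    | 0 => S.ε ≫ κ
    | i + 1 => S.d i
  ι
    | 0 => κ
    | i + 1 => S.ι i
  π
    | 0 => S.ε
    | i + 1 => S.π i
  fac
    | 0, _ => rfl
    | i + 1, hi => S.fac i (by lia)
  exact_zero := h
  exact_succ
    | 0, _ => S.exact_zero
    | i + 1, hi => S.exact_succ i (by lia)

/-- The part of a sequence ending in the first kernel. -/
def tail {k : ℕ} {X : C} (S : E.LeftSequence (k + 1) X) : E.LeftSequence k (S.K 0) where
  N i := S.N (i + 1)
  K i := S.K (i + 1)
  ε := S.π 0
  d i := S.d (i + 1)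
  ι i := S.ι (i + 1)
  π i := S.π (i + 1)
  fac i hi := S.fac (i + 1) (by lia)
  exact_zero := S.exact_succ 0 (by lia)
  exact_succ i hi := S.exact_succ (i + 1) (by lia)

lemma HomExact.cons {k : ℕ} {K N X : C} {κ : K ⟶ N} {p : N ⟶ X} (h : E.IsShortExact κ p)
    {S : E.LeftSequence k K} {T : C} (hT : ∀ f : T ⟶ X, ∃ g : T ⟶ N, g ≫ p = f)
    (hS : S.HomExact T) : (S.cons h).HomExact T where
  surjective := hT
  exact_zero _ g := by
    refine ⟨fun hg => ?_, ?_⟩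
    · obtain ⟨s, rfl⟩ := h.exists_lift g hg
      obtain ⟨t, rfl⟩ := hS.surjective s
      exact ⟨t, (Category.assoc _ _ _).symm⟩
    · rintro ⟨t : T ⟶ S.N 0, rfl⟩
      change (t ≫ S.ε ≫ κ) ≫ p = 0
      simp only [Category.assoc, h.zero, comp_zero]
  exact_succ
    | 0, hi => fun (g : T ⟶ S.N 0) => by
      have := h.mono
      refine Iff.trans ?_ (hS.exact_zero (by lia) g)
      change g ≫ S.ε ≫ κ = 0 ↔ g ≫ S.ε = 0
      rw [← Category.assoc]
      exact ⟨fun h => zero_of_comp_mono _ h, fun h => by rw [h, zero_comp]⟩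
    | i + 1, hi => hS.exact_succ i (by lia)

lemma HomExact.tail {k : ℕ} {X : C} {S : E.LeftSequence (k + 1) X} {T : C}
    (hS : S.HomExact T) : S.tail.HomExact T where
  surjective (g : T ⟶ S.K 0) := by
    have := S.exact_zero.mono
    obtain ⟨t, ht⟩ := (hS.exact_zero (by lia) (g ≫ S.ι 0)).1
      (by
      change (g ≫ S.ι 0) ≫ S.ε = 0
      rw [Category.assoc, S.exact_zero.zero, comp_zero])
    refine ⟨t, ?_⟩
    rw [← cancel_mono (S.ι 0), ← ht]
    exact (Category.assoc _ _ _).trans (congrArg (t ≫ ·) (S.fac 0 (by lia)))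
  exact_zero hk (g : T ⟶ S.N 1) := by
    have := S.exact_zero.mono
    refine Iff.trans ?_ (hS.exact_succ 0 (by lia) g)
    change g ≫ S.π 0 = 0 ↔ g ≫ S.d 0 = 0
    rw [← S.fac 0 (by lia), ← Category.assoc]
    exact ⟨fun h => by rw [h, zero_comp], fun h => zero_of_comp_mono _ h⟩
  exact_succ i hi := hS.exact_succ (i + 1) (by lia)

end LeftSequence

/-- As each `K i ⟶ N i` is a kernel of the map that follows it, exactness of the `Hom` sequence at
`N i` says precisely that maps from `M` into `K i` lift to `N (i + 1)`. -/
lemma gen_iff_isGen {k : ℕ} {X : C} : E.gen M k X ↔ E.IsGen M k X := by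
  induction k generalizing X with
  | zero =>
    constructor
    · rintro ⟨S, hN, hS⟩
      exact ⟨_, _, _, _, hN 0 le_rfl, S.exact_zero, fun T hT => (hS T hT).surjective⟩
    · rintro ⟨K, N, κ, p, h⟩
      refine ⟨.single h.exact, fun _ _ => h.mem, fun T hT => ⟨h.lift T hT, ?_, ?_⟩⟩
      · intro h0
        exact absurd h0 (lt_irrefl 0)
      · intro i hi
        exact absurd hi (Nat.not_lt_zero _)
  | succ k ih =>
    constructor
    · rintro ⟨S, hN, hS⟩
      exact ⟨_, _, _, _, ⟨hN 0 (by lia), S.exact_zero, fun T hT => (hS T hT).surjective⟩,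
        ih.1 ⟨S.tail, fun i hi => hN (i + 1) (by lia), fun T hT => (hS T hT).tail⟩⟩
    · rintro ⟨K, N, κ, p, h, hK⟩
      obtain ⟨S, hN, hS⟩ := ih.2 hK
      refine ⟨S.cons h.exact, ?_, fun T hT => (hS T hT).cons h.exact (h.lift T hT)⟩
      rintro (_ | i) hi
      · exact h.mem
      · exact hN i (by lia)

namespace RightSequence

/-- The sequence consisting of one conflation. -/
def single {X N K : C} {i : X ⟶ N} {q : N ⟶ K} (h : E.IsShortExact i q) :
    E.RightSequence 0 X where
  N _ := N
  K _ := K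
  η := i
  d _ := 0
  ι _ := 0
  π _ := q
  fac _ hi := absurd hi (Nat.not_lt_zero _)
  exact_zero := h
  exact_succ _ hi := absurd hi (Nat.not_lt_zero _)

/-- Splicing a conflation with a sequence starting in its cokernel. -/
def cons {k : ℕ} {X N K : C} {i : X ⟶ N} {q : N ⟶ K} (h : E.IsShortExact i q)
    (S : E.RightSequence k K) : E.RightSequence (k + 1) X where
  N
    | 0 => N
    | i + 1 => S.N i
  K
    | 0 => K
    | i + 1 => S.K i
  η := i
  d
    | 0 => q ≫ S.η
    | i + 1 => S.d i
  ι
    | 0 => S.η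
    | i + 1 => S.ι i
  π
    | 0 => q
    | i + 1 => S.π i
  fac
    | 0, _ => rfl
    | i + 1, hi => S.fac i (by lia)
  exact_zero := h
  exact_succ
    | 0, _ => S.exact_zero
    | i + 1, hi => S.exact_succ i (by lia)

/-- The part of a sequence starting in the first cokernel. -/
def tail {k : ℕ} {X : C} (S : E.RightSequence (k + 1) X) : E.RightSequence k (S.K 0) where
  N i := S.N (i + 1)
  K i := S.K (i + 1)
  η := S.ι 0
  d i := S.d (i + 1)
  ι i := S.ι (i + 1)
  π i := S.π (i + 1)
  fac i hi := S.fac (i + 1) (by lia)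
  exact_zero := S.exact_succ 0 (by lia)
  exact_succ i hi := S.exact_succ (i + 1) (by lia)

lemma HomExact.cons {k : ℕ} {X N K : C} {i : X ⟶ N} {q : N ⟶ K} (h : E.IsShortExact i q)
    {S : E.RightSequence k K} {T : C} (hT : ∀ f : X ⟶ T, ∃ g : N ⟶ T, i ≫ g = f)
    (hS : S.HomExact T) : (S.cons h).HomExact T where
  surjective := hT
  exact_zero _ g := by
    refine ⟨fun hg => ?_, ?_⟩
    · obtain ⟨s, rfl⟩ := h.exists_desc g hg
      obtain ⟨t, rfl⟩ := hS.surjective s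
      exact ⟨t, Category.assoc _ _ _⟩
    · rintro ⟨t : S.N 0 ⟶ T, rfl⟩
      change i ≫ (q ≫ S.η) ≫ t = 0
      simp only [Category.assoc, reassoc_of% h.zero, zero_comp]
  exact_succ
    | 0, hi => fun (g : S.N 0 ⟶ T) => by
      have := h.epi
      refine Iff.trans ?_ (hS.exact_zero (by lia) g)
      change (q ≫ S.η) ≫ g = 0 ↔ S.η ≫ g = 0
      rw [Category.assoc]
      exact ⟨fun h => zero_of_epi_comp _ h, fun h => by rw [h, comp_zero]⟩
    | i + 1, hi => hS.exact_succ i (by lia)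

lemma HomExact.tail {k : ℕ} {X : C} {S : E.RightSequence (k + 1) X} {T : C}
    (hS : S.HomExact T) : S.tail.HomExact T where
  surjective (g : S.K 0 ⟶ T) := by
    have := S.exact_zero.epi
    obtain ⟨t, ht⟩ := (hS.exact_zero (by lia) (S.π 0 ≫ g)).1
      (by
      change S.η ≫ S.π 0 ≫ g = 0
      rw [← Category.assoc, S.exact_zero.zero, zero_comp])
    refine ⟨t, ?_⟩
    rw [← cancel_epi (S.π 0), ← ht]
    exact (Category.assoc _ _ _).symm.trans (congrArg (· ≫ t) (S.fac 0 (by lia)))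
  exact_zero hk (g : S.N 1 ⟶ T) := by
    have := S.exact_zero.epi
    refine Iff.trans ?_ (hS.exact_succ 0 (by lia) g)
    change S.ι 0 ≫ g = 0 ↔ S.d 0 ≫ g = 0
    rw [← S.fac 0 (by lia), Category.assoc]
    exact ⟨fun h => by rw [h, comp_zero], fun h => zero_of_epi_comp _ h⟩
  exact_succ i hi := hS.exact_succ (i + 1) (by lia)

end RightSequence

lemma cogen_iff_isCogen {k : ℕ} {X : C} : E.cogen M k X ↔ E.IsCogen M k X := by
  induction k generalizing X with
  | zero =>
    constructor
    · rintro ⟨S, hN, hS⟩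
      exact ⟨_, _, _, _, hN 0 le_rfl, S.exact_zero, fun T hT => (hS T hT).surjective⟩
    · rintro ⟨N, K, i, q, h⟩
      refine ⟨.single h.exact, fun _ _ => h.mem, fun T hT => ⟨h.extend T hT, ?_, ?_⟩⟩
      · intro h0
        exact absurd h0 (lt_irrefl 0)
      · intro i hi
        exact absurd hi (Nat.not_lt_zero _)
  | succ k ih =>
    constructor
    · rintro ⟨S, hN, hS⟩
      exact ⟨_, _, _, _, ⟨hN 0 (by lia), S.exact_zero, fun T hT => (hS T hT).surjective⟩,
        ih.1 ⟨S.tail, fun i hi => hN (i + 1) (by lia), fun T hT => (hS T hT).tail⟩⟩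
    · rintro ⟨N, K, i, q, h, hK⟩
      obtain ⟨S, hN, hS⟩ := ih.2 hK
      refine ⟨S.cons h.exact, ?_, fun T hT => (hS T hT).cons h.exact (h.extend T hT)⟩
      rintro (_ | i) hi
      · exact h.mem
      · exact hN i (by lia)

end ExactStructure

/-! ### Finitely generated and projective modules. -/

section ModuleLemmas

variable {A : Type u} [Category.{v} A] [Preadditive A]

lemma epi_of_surjective {F G : A ⥤+ AddCommGrpCat.{v}} (e : F ⟶ G)
    (he : ∀ a, Function.Surjective (e.hom.app a)) : Epi e where
  left_cancellation f g h := by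
    ext a x
    obtain ⟨y, rfl⟩ := he a x
    exact congrArg (fun φ : F ⟶ _ => φ.hom.app a y) h

/-- The cokernel formed among all functors is again additive, so it vanishes when `e` is epi among
additive functors; hence `e` is epi among all functors, that is, pointwise. -/
lemma surjective_of_epi {F G : A ⥤+ AddCommGrpCat.{v}} (e : F ⟶ G) [Epi e] (a : A) :
    Function.Surjective (e.hom.app a) := by
  have : (cokernel e.hom).Additive :=
    ⟨fun {X Y f g} => by
      rw [← cancel_epi ((cokernel.π e.hom).app X)]
      simp only [Preadditive.comp_add, ← NatTrans.naturality, Functor.map_add,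
        Preadditive.add_comp]⟩
  let π : G ⟶ AdditiveFunctor.of (cokernel e.hom) := ⟨cokernel.π e.hom⟩
  have hπ : π = 0 := by
    rw [← cancel_epi e, comp_zero]
    exact ObjectProperty.hom_ext _ (cokernel.condition e.hom)
  have : Epi e.hom := Preadditive.epi_of_cokernel_zero (congrArg (fun φ => φ.hom) hπ)
  exact (AddCommGrpCat.epi_iff_surjective _).1 inferInstance

lemma naturality_apply {F G : A ⥤+ AddCommGrpCat.{v}} (φ : F ⟶ G) {a b : A} (f : a ⟶ b)
    (x : F.obj.obj a) : φ.hom.app b (F.obj.map f x) = G.obj.map f (φ.hom.app a x) :=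
  NatTrans.naturality_apply φ.hom f x

lemma map_add_apply (F : A ⥤+ AddCommGrpCat.{v}) {a b : A} (f g : a ⟶ b) (x : F.obj.obj a) :
    F.obj.map (f + g) x = F.obj.map f x + F.obj.map g x := by
  rw [Functor.map_add]
  rfl

lemma map_id_apply (F : A ⥤+ AddCommGrpCat.{v}) {a : A} (x : F.obj.obj a) :
    F.obj.map (𝟙 a) x = x := by
  rw [F.obj.map_id]
  rfl

lemma map_comp_apply (F : A ⥤+ AddCommGrpCat.{v}) {a b c : A} (f : a ⟶ b) (g : b ⟶ c)
    (x : F.obj.obj a) : F.obj.map (f ≫ g) x = F.obj.map g (F.obj.map f x) := by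
  rw [Functor.map_comp]
  rfl

/-- `F` is represented by `a` with universal element `x`. -/
def IsUniversal (F : A ⥤+ AddCommGrpCat.{v}) {a : A} (x : F.obj.obj a) : Prop :=
  ∀ b, Function.Bijective (fun f : a ⟶ b => F.obj.map f x)

namespace IsUniversal

variable {F : A ⥤+ AddCommGrpCat.{v}} {a : A} {x : F.obj.obj a}

/-- The existence half of Yoneda's lemma, in terms of elements so that it serves `homTo` and
`homFrom` alike. -/
lemma exists_hom (h : IsUniversal F x) (G : A ⥤+ AddCommGrpCat.{v}) (y : G.obj.obj a) :
    ∃ φ : F ⟶ G, φ.hom.app a x = y := by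
  choose s hs using fun b => (h b).2
  replace hs : ∀ b z, F.obj.map (s b z) x = z := hs
  refine ⟨⟨{ app b := AddCommGrpCat.ofHom (AddMonoidHom.mk' (fun z => G.obj.map (s b z) y) ?_)
             naturality b c f := ?_ }⟩, ?_⟩
  · intro z w
    rw [← map_add_apply]
    have : s b (z + w) = s b z + s b w := (h b).1 (by
      change F.obj.map _ x = F.obj.map _ x
      rw [map_add_apply, hs, hs, hs])
    rw [this]
  · ext z
    change G.obj.map (s c (F.obj.map f z)) y = G.obj.map f (G.obj.map (s b z) y)
    rw [← map_comp_apply]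
    have : s c (F.obj.map f z) = s b z ≫ f := (h c).1 (by
      change F.obj.map _ x = F.obj.map _ x
      rw [map_comp_apply, hs, hs])
    rw [this]
  · change G.obj.map (s a x) y = y
    have : s a x = 𝟙 a := (h a).1 (by simp [hs])
    simp [this]

lemma hom_ext (h : IsUniversal F x) {G : A ⥤+ AddCommGrpCat.{v}} {φ ψ : F ⟶ G}
    (hx : φ.hom.app a x = ψ.hom.app a x) : φ = ψ := by
  ext b z
  obtain ⟨f, rfl⟩ := (h b).2 z
  change φ.hom.app b (F.obj.map f x) = ψ.hom.app b (F.obj.map f x)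
  rw [naturality_apply, naturality_apply, hx]

lemma projective (h : IsUniversal F x) : Projective F where
  factors {X Y} f e _ := by
    obtain ⟨y, hy⟩ := surjective_of_epi e a (f.hom.app a x)
    obtain ⟨φ, hφ⟩ := h.exists_hom _ y
    refine ⟨φ, h.hom_ext ?_⟩
    change e.hom.app a (φ.hom.app a x) = _
    rw [hφ, hy]

end IsUniversal

lemma exists_isUniversal (a : A) : ∃ (F : A ⥤+ AddCommGrpCat.{v}) (x : F.obj.obj a),
    IsUniversal F x := by
  refine ⟨AdditiveFunctor.of (preadditiveCoyoneda.obj (Opposite.op a)), 𝟙 a, fun b => ?_⟩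
  exact ⟨fun f g h => (Category.id_comp f).symm.trans (h.trans (Category.id_comp g)),
    fun f => ⟨f, Category.id_comp f⟩⟩

/-- `x` generates `F`. -/
def IsGenerator (F : A ⥤+ AddCommGrpCat.{v}) {a : A} (x : F.obj.obj a) : Prop :=
  ∀ b (y : F.obj.obj b), ∃ f : a ⟶ b, F.obj.map f x = y

lemma IsUniversal.isGenerator {F : A ⥤+ AddCommGrpCat.{v}} {a : A} {x : F.obj.obj a}
    (h : IsUniversal F x) : IsGenerator F x := fun b => (h b).2

lemma IsGenerator.isFinGen {F : A ⥤+ AddCommGrpCat.{v}} {a : A} {x : F.obj.obj a}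
    (h : IsGenerator F x) : IsFinGen F := by
  refine ⟨1, fun _ => a, fun _ => x, fun b y => ?_⟩
  obtain ⟨f, rfl⟩ := h b y
  exact ⟨fun _ => f, by simp⟩

lemma IsFinGen.of_surjective {F G : A ⥤+ AddCommGrpCat.{v}} (h : IsFinGen F) (e : F ⟶ G)
    (he : ∀ a, Function.Surjective (e.hom.app a)) : IsFinGen G := by
  obtain ⟨n, a, x, hx⟩ := h
  refine ⟨n, a, fun i => e.hom.app _ (x i), fun b y => ?_⟩
  obtain ⟨z, rfl⟩ := he b y
  obtain ⟨f, rfl⟩ := hx b z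
  exact ⟨f, by simp only [map_sum, naturality_apply]⟩

/-- The product of two modules. -/
def prodModule (F G : A ⥤+ AddCommGrpCat.{v}) : A ⥤+ AddCommGrpCat.{v} where
  obj :=
    { obj a := AddCommGrpCat.of (F.obj.obj a × G.obj.obj a)
      map f := AddCommGrpCat.ofHom
        (AddMonoidHom.prodMap (F.obj.map f).hom (G.obj.map f).hom)
      map_id a := by
        refine AddCommGrpCat.hom_ext (AddMonoidHom.ext fun x => Prod.ext ?_ ?_)
        · exact map_id_apply F x.1
        · exact map_id_apply G x.2
      map_comp f g := by
        refine AddCommGrpCat.hom_ext (AddMonoidHom.ext fun x => Prod.ext ?_ ?_)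
        · exact map_comp_apply F f g x.1
        · exact map_comp_apply G f g x.2 }
  property :=
    ⟨fun {a b f g} => by
      refine AddCommGrpCat.hom_ext (AddMonoidHom.ext fun x => Prod.ext ?_ ?_)
      · exact map_add_apply F f g x.1
      · exact map_add_apply G f g x.2⟩

/-- The morphism from a product of modules given by two morphisms. -/
def prodDesc {F G H : A ⥤+ AddCommGrpCat.{v}} (φ : F ⟶ H) (ψ : G ⟶ H) : prodModule F G ⟶ H where
  hom :=
    { app a := AddCommGrpCat.ofHom (AddMonoidHom.coprod (φ.hom.app a).hom (ψ.hom.app a).hom)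
      naturality a b f := by
        ext x
        change φ.hom.app b (F.obj.map f x.1) + ψ.hom.app b (G.obj.map f x.2) =
          H.obj.map f (φ.hom.app a x.1 + ψ.hom.app a x.2)
        rw [naturality_apply, naturality_apply, map_add] }

/-- The morphism to a product of modules given by two morphisms. -/
def prodLift {F G H : A ⥤+ AddCommGrpCat.{v}} (φ : H ⟶ F) (ψ : H ⟶ G) : H ⟶ prodModule F G where
  hom :=
    { app a := AddCommGrpCat.ofHom (AddMonoidHom.prod (φ.hom.app a).hom (ψ.hom.app a).hom)
      naturality a b f := by
        ext x
        exact Prod.ext (naturality_apply φ f x) (naturality_apply ψ f x) }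

lemma projective_prodModule {F G : A ⥤+ AddCommGrpCat.{v}} (hF : Projective F)
    (hG : Projective G) : Projective (prodModule F G) where
  factors {X Y} f e _ := by
    obtain ⟨φ, hφ⟩ := hF.factors (prodLift (𝟙 F) 0 ≫ f) e
    obtain ⟨ψ, hψ⟩ := hG.factors (prodLift 0 (𝟙 G) ≫ f) e
    refine ⟨prodDesc φ ψ, ?_⟩
    ext a x
    have h₁ : e.hom.app a (φ.hom.app a x.1) = f.hom.app a (x.1, 0) :=
      congrArg (fun θ : F ⟶ Y => θ.hom.app a x.1) hφ
    have h₂ : e.hom.app a (ψ.hom.app a x.2) = f.hom.app a (0, x.2) :=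
      congrArg (fun θ : G ⟶ Y => θ.hom.app a x.2) hψ
    change e.hom.app a (φ.hom.app a x.1 + ψ.hom.app a x.2) = f.hom.app a x
    rw [map_add, h₁, h₂]
    refine (map_add (f.hom.app a).hom _ _).symm.trans (congrArg (f.hom.app a) ?_)
    exact Prod.ext (add_zero _) (zero_add _)

lemma modK.isFinGen {k : ℕ} {F : A ⥤+ AddCommGrpCat.{v}} (h : modK A k F) : IsFinGen F := by
  obtain ⟨S⟩ := h
  exact (S.finGen 0 (Nat.zero_le _)).of_surjective S.ε S.surjective

section Biproducts

variable [HasFiniteBiproducts A]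

/-- Finitely many generators merge into one over the biproduct; this is how a finitely generated
`Hom` module yields a single approximating object. -/
lemma IsFinGen.exists_isGenerator {F : A ⥤+ AddCommGrpCat.{v}} (h : IsFinGen F) :
    ∃ (a : A) (x : F.obj.obj a), IsGenerator F x := by
  obtain ⟨n, a, x, hx⟩ := h
  refine ⟨⨁ a, ∑ i, F.obj.map (biproduct.ι a i) (x i), fun b y => ?_⟩
  obtain ⟨f, rfl⟩ := hx b y
  refine ⟨biproduct.desc f, ?_⟩
  simp only [map_sum, ← map_comp_apply, biproduct.ι_desc]

lemma isFinGen_prodModule {F G : A ⥤+ AddCommGrpCat.{v}} (hF : IsFinGen F) (hG : IsFinGen G) :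
    IsFinGen (prodModule F G) := by
  have := hasBinaryBiproducts_of_finite_biproducts A
  obtain ⟨a, x, hx⟩ := hF.exists_isGenerator
  obtain ⟨b, y, hy⟩ := hG.exists_isGenerator
  refine IsGenerator.isFinGen (a := a ⊞ b)
    (x := (F.obj.map biprod.inl x, G.obj.map biprod.inr y)) ?_
  rintro c ⟨z, w⟩
  obtain ⟨f, rfl⟩ := hx c z
  obtain ⟨g, rfl⟩ := hy c w
  refine ⟨biprod.desc f g, Prod.ext ?_ ?_⟩
  · change F.obj.map (biprod.desc f g) (F.obj.map biprod.inl x) = F.obj.map f x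
    rw [← map_comp_apply, biprod.inl_desc]
  · change G.obj.map (biprod.desc f g) (G.obj.map biprod.inr y) = G.obj.map g y
    rw [← map_comp_apply, biprod.inr_desc]

/-- A morphism from a finitely generated projective module lifts along any morphism whose image
contains its image. -/
lemma exists_lift_of_projective {P G H : A ⥤+ AddCommGrpCat.{v}} (hP : IsFinGen P)
    (hP' : Projective P) (d : G ⟶ H) (φ : P ⟶ H)
    (h : ∀ a (y : P.obj.obj a), ∃ z, d.hom.app a z = φ.hom.app a y) :
    ∃ γ : P ⟶ G, ∀ a y, d.hom.app a (γ.hom.app a y) = φ.hom.app a y := by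
  obtain ⟨a, x, hx⟩ := hP.exists_isGenerator
  obtain ⟨R, u, hu⟩ := exists_isUniversal a
  -- The representable `R` covers `P`, and projectivity splits the cover; it then suffices to lift
  -- from `R`, which means choosing one preimage.
  obtain ⟨r, hr⟩ := hu.exists_hom P x
  have : Epi r := epi_of_surjective r fun b y => by
    obtain ⟨f, rfl⟩ := hx b y
    exact ⟨R.obj.map f u, by rw [naturality_apply, hr]⟩
  obtain ⟨s, hs⟩ := hP'.factors (𝟙 P) r
  obtain ⟨z, hz⟩ := h a x
  obtain ⟨t, ht⟩ := hu.exists_hom G z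
  have htd : t ≫ d = r ≫ φ := hu.hom_ext (by
    change d.hom.app a (t.hom.app a u) = φ.hom.app a (r.hom.app a u)
    rw [ht, hr, hz])
  have key : (s ≫ t) ≫ d = φ := by
    rw [Category.assoc, htd, ← Category.assoc, hs, Category.id_comp]
  exact ⟨s ≫ t, fun b y => congrArg (fun θ : P ⟶ H => θ.hom.app b y) key⟩

/-- Schanuel's lemma: the kernel of a surjection from a finitely generated projective module onto
a module in `modK (n + 1)` is in `modK n`. -/
theorem modK.kernel {n : ℕ} {K R F : A ⥤+ AddCommGrpCat.{v}} (hF : modK A (n + 1) F)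
    (ι : K ⟶ R) (p : R ⟶ F) (hR : IsFinGen R) (hR' : Projective R)
    (hι : ∀ a, Function.Injective (ι.hom.app a)) (hp : ∀ a, Function.Surjective (p.hom.app a))
    (hex : ∀ a, Function.Exact (ι.hom.app a) (p.hom.app a)) : modK A n K := by
  obtain ⟨S⟩ := hF
  have hz : ∀ a q, S.ε.hom.app a ((S.d 0).hom.app a q) = 0 := fun a =>
    (S.exact_zero (Nat.succ_pos n) a).apply_apply_eq_zero
  -- `α` and `β` compare the two covers of `F`, and `γ` is a homotopy: `d₀γ = 1 - αβ`.
  obtain ⟨α, hα⟩ := exists_lift_of_projective hR hR' S.ε p fun a y => S.surjective a _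
  obtain ⟨β, hβ⟩ := exists_lift_of_projective (S.finGen 0 (by lia)) (S.projective 0 (by lia)) p S.ε
    fun a y => hp a _
  obtain ⟨γ, hγ⟩ := exists_lift_of_projective (S.finGen 0 (by lia)) (S.projective 0 (by lia))
    (S.d 0) (𝟙 _ - β ≫ α) fun a y => (S.exact_zero (Nat.succ_pos n) a _).1 (by
      change S.ε.hom.app a (y - α.hom.app a (β.hom.app a y)) = 0
      rw [map_sub, hα, hβ, sub_self])
  replace hγ : ∀ a y, (S.d 0).hom.app a (γ.hom.app a y) = y - α.hom.app a (β.hom.app a y) := hγ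
  have hfg : ∀ i, i ≤ n → IsFinGen (S.P (i + 1)) := fun i hi => S.finGen (i + 1) (by lia)
  have hpr : ∀ i, i ≤ n → Projective (S.P (i + 1)) := fun i hi => S.projective (i + 1) (by lia)
  have hfg₀ := isFinGen_prodModule (hfg 0 (Nat.zero_le n)) hR
  have hpr₀ := projective_prodModule (hpr 0 (Nat.zero_le n)) hR'
  obtain ⟨e, he⟩ := exists_lift_of_projective hfg₀ hpr₀ ι
    (prodDesc (-(S.d 0 ≫ β)) (𝟙 R - α ≫ β)) (by
      rintro a ⟨q, r⟩
      refine (hex a _).1 ?_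
      change p.hom.app a (-β.hom.app a ((S.d 0).hom.app a q) +
        (r - β.hom.app a (α.hom.app a r))) = 0
      rw [map_add, map_neg, map_sub, hβ, hβ, hα, hz, neg_zero, sub_self, add_zero])
  replace he : ∀ a q r, ι.hom.app a (e.hom.app a (q, r)) =
      -β.hom.app a ((S.d 0).hom.app a q) + (r - β.hom.app a (α.hom.app a r)) :=
    fun a q r => he a (q, r)
  -- The new presentation is `⋯ → S.P 3 → S.P 2 ⊕ S.P 0 → S.P 1 ⊕ R → K`: by Schanuel `S.P 1 ⊕ R`
  -- covers `K ⊕ S.P 0`, and the copy of `S.P 0` in degree one cancels the extra summand.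
  let P : ℕ → (A ⥤+ AddCommGrpCat.{v})
    | 0 => prodModule (S.P 1) R
    | 1 => prodModule (S.P 2) (S.P 0)
    | i + 2 => S.P (i + 3)
  let d : ∀ i, P (i + 1) ⟶ P i
    | 0 => prodLift (prodDesc (S.d 1) γ) (prodDesc 0 β)
    | 1 => prodLift (S.d 2) 0
    | i + 2 => S.d (i + 3)
  have hd₀ : ∀ a q y, (d 0).hom.app a (q, y) =
      ((S.d 1).hom.app a q + γ.hom.app a y, β.hom.app a y) := fun a q y =>
    Prod.ext rfl (zero_add _)
  have hd₁ : ∀ a q, (d 1).hom.app a q = ((S.d 2).hom.app a q, 0) := fun a q => rfl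
  refine ⟨⟨P, e, d, ?_, ?_, ?_, ?_, ?_⟩⟩
  · rintro (_ | _ | i) hi
    · exact hfg₀
    · exact isFinGen_prodModule (hfg 1 hi) (S.finGen 0 (Nat.zero_le _))
    · exact hfg (i + 2) hi
  · rintro (_ | _ | i) hi
    · exact hpr₀
    · exact projective_prodModule (hpr 1 hi) (S.projective 0 (Nat.zero_le _))
    · exact hpr (i + 2) hi
  · intro a k
    have hk : p.hom.app a (ι.hom.app a k) = 0 := (hex a).apply_apply_eq_zero k
    obtain ⟨q, hq⟩ := (S.exact_zero (Nat.succ_pos n) a (-α.hom.app a (ι.hom.app a k))).1 (by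
      rw [map_neg, hα, hk, neg_zero])
    refine ⟨(q, ι.hom.app a k), hι a ?_⟩
    rw [he, hq, map_neg, neg_neg, add_sub_cancel]
  · rintro hn a ⟨q, r⟩
    have hdd : ∀ x, (S.d 0).hom.app a ((S.d 1).hom.app a x) = 0 :=
      (S.exact_succ 0 (by lia) a).apply_apply_eq_zero
    constructor
    · intro h
      have h' := (he a q r).symm.trans ((congrArg (ι.hom.app a) h).trans (map_zero _))
      have hr : β.hom.app a ((S.d 0).hom.app a q + α.hom.app a r) = r := by
        rw [map_add, ← sub_eq_zero, ← neg_eq_zero, ← h']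
        abel
      -- Vanishing of `e (q, r)` gives `β y = r`, hence `d₀ (q - γ y) = 0`, and `(x, y)` is a
      -- preimage of `(q, r)`.
      set y := (S.d 0).hom.app a q + α.hom.app a r with hy
      obtain ⟨x, hx⟩ := (S.exact_succ 0 (by lia) a (q - γ.hom.app a y)).1 (by
        rw [map_sub, hγ, hr, hy]
        abel)
      refine ⟨(x, y), ?_⟩
      rw [hd₀, hx, hr, sub_add_cancel]
    · rintro ⟨⟨x, y⟩, hxy⟩
      rw [← hxy, hd₀]
      refine hι a ?_
      rw [he, map_add, hdd, hγ, map_zero, zero_add, map_sub]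
      abel
  · rintro (_ | _ | i) hi a
    · intro x
      obtain ⟨x, y⟩ := x
      rw [hd₀]
      constructor
      · intro h
        obtain ⟨h₁, h₂⟩ := Prod.ext_iff.1 h
        have hdd : ∀ x, (S.d 0).hom.app a ((S.d 1).hom.app a x) = 0 :=
          (S.exact_succ 0 (by lia) a).apply_apply_eq_zero
        -- Apply `d₀` to the first component: `d₀γ y = y - αβ y`, and `β y = 0` by the second.
        have hy : y = 0 := by
          have := congrArg ((S.d 0).hom.app a) h₁
          change (S.d 0).hom.app a ((S.d 1).hom.app a x + γ.hom.app a y) =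
            (S.d 0).hom.app a 0 at this
          change β.hom.app a y = 0 at h₂
          rwa [map_add, hdd, hγ, h₂, map_zero, map_zero, sub_zero, zero_add] at this
        subst hy
        obtain ⟨z, rfl⟩ := (S.exact_succ 1 (by lia) a x).1 (by
          change (S.d 1).hom.app a x + γ.hom.app a 0 = 0 at h₁
          rwa [map_zero, add_zero] at h₁)
        exact ⟨z, rfl⟩
      · rintro ⟨z, hz'⟩
        obtain ⟨h₁, h₂⟩ := Prod.ext_iff.1 ((hd₁ a z).symm.trans hz')
        change _ = x at h₁
        change 0 = y at h₂
        subst h₁ h₂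
        rw [map_zero, map_zero, add_zero]
        exact Prod.ext ((S.exact_succ 1 (by lia) a).apply_apply_eq_zero z) rfl
    · intro x
      refine Iff.trans ?_ (S.exact_succ 2 (by lia) a x)
      exact ⟨fun h => (Prod.ext_iff.1 h).1, fun h => Prod.ext h rfl⟩
    · exact S.exact_succ (i + 3) (by lia) a

end Biproducts

end ModuleLemmas

/-! ### The modules `Hom(-, X)|_M` and `Hom(X, -)|_M`. -/

section HomModules

variable {C : Type u} [Category.{v} C] [Preadditive C] (M : ObjectProperty C)

/-- Functoriality of `homTo`. -/
noncomputable def homToMap {X Y : C} (f : X ⟶ Y) : homTo M X ⟶ homTo M Y :=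
  ⟨Functor.whiskerLeft M.ι.op (preadditiveYoneda.map f)⟩

/-- Functoriality of `homFrom`. -/
noncomputable def homFromMap {X Y : C} (f : X ⟶ Y) : homFrom M Y ⟶ homFrom M X :=
  ⟨Functor.whiskerLeft M.ι (preadditiveCoyoneda.map f.op)⟩

variable {M}

lemma exists_isUniversal_homTo {N : C} (hN : M N) :
    ∃ x : (homTo M N).obj.obj (Opposite.op ⟨N, hN⟩), IsUniversal (homTo M N) x := by
  refine ⟨𝟙 N, fun b => ⟨fun f g h => ?_, fun (f : b.unop.obj ⟶ N) =>
    ⟨Quiver.Hom.op (ObjectProperty.homMk f), Category.comp_id f⟩⟩⟩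
  exact Quiver.Hom.unop_inj (ObjectProperty.hom_ext _
    ((Category.comp_id f.unop.hom).symm.trans (h.trans (Category.comp_id g.unop.hom))))

lemma exists_isUniversal_homFrom {N : C} (hN : M N) :
    ∃ x : (homFrom M N).obj.obj ⟨N, hN⟩, IsUniversal (homFrom M N) x := by
  refine ⟨𝟙 N, fun b => ⟨fun f g h => ?_, fun (f : N ⟶ b.obj) =>
    ⟨ObjectProperty.homMk f, Category.id_comp f⟩⟩⟩
  exact ObjectProperty.hom_ext _
    ((Category.id_comp f.hom).symm.trans (h.trans (Category.id_comp g.hom)))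

variable {E : ExactStructure C}

lemma modK_homTo_of_gen {k : ℕ} {X : C} (h : E.gen M k X) :
    modK M.FullSubcategoryᵒᵖ k (homTo M X) := by
  obtain ⟨S, hN, hS⟩ := h
  exact ⟨{
    P i := homTo M (S.N i)
    ε := homToMap M S.ε
    d i := homToMap M (S.d i)
    finGen i hi := (exists_isUniversal_homTo (hN i hi)).choose_spec.isGenerator.isFinGen
    projective i hi := (exists_isUniversal_homTo (hN i hi)).choose_spec.projective
    surjective a := (hS _ a.unop.property).surjective
    exact_zero hk a := (hS _ a.unop.property).exact_zero hk
    exact_succ i hi a := (hS _ a.unop.property).exact_succ i hi }⟩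

lemma modK_homFrom_of_cogen {k : ℕ} {X : C} (h : E.cogen M k X) :
    modK M.FullSubcategory k (homFrom M X) := by
  obtain ⟨S, hN, hS⟩ := h
  exact ⟨{
    P i := homFrom M (S.N i)
    ε := homFromMap M S.η
    d i := homFromMap M (S.d i)
    finGen i hi := (exists_isUniversal_homFrom (hN i hi)).choose_spec.isGenerator.isFinGen
    projective i hi := (exists_isUniversal_homFrom (hN i hi)).choose_spec.projective
    surjective a := (hS _ a.property).surjective
    exact_zero hk a := (hS _ a.property).exact_zero hk
    exact_succ i hi a := (hS _ a.property).exact_succ i hi }⟩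

lemma exists_rightApprox_of_isFinGen [HasFiniteBiproducts M.FullSubcategoryᵒᵖ] {X : C}
    (h : IsFinGen (homTo M X)) :
    ∃ (N : C) (g : N ⟶ X), M N ∧ ∀ T, M T → ∀ f : T ⟶ X, ∃ h : T ⟶ N, h ≫ g = f := by
  obtain ⟨a, x, hx⟩ := h.exists_isGenerator
  refine ⟨a.unop.obj, x, a.unop.property, fun T hT f => ?_⟩
  obtain ⟨g, hg⟩ := hx (Opposite.op ⟨T, hT⟩) f
  exact ⟨g.unop.hom, hg⟩

lemma exists_leftApprox_of_isFinGen [HasFiniteBiproducts M.FullSubcategory] {X : C}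
    (h : IsFinGen (homFrom M X)) :
    ∃ (N : C) (g : X ⟶ N), M N ∧ ∀ T, M T → ∀ f : X ⟶ T, ∃ h : N ⟶ T, g ≫ h = f := by
  obtain ⟨a, x, hx⟩ := h.exists_isGenerator
  refine ⟨a.obj, x, a.property, fun T hT f => ?_⟩
  obtain ⟨g, hg⟩ := hx ⟨T, hT⟩ f
  exact ⟨g.hom, hg⟩

lemma modK_homTo_kernel [HasFiniteBiproducts M.FullSubcategoryᵒᵖ] {n : ℕ} {K N X : C}
    {κ : K ⟶ N} {p : N ⟶ X} (h : E.IsRightApprox M κ p)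
    (hX : modK M.FullSubcategoryᵒᵖ (n + 1) (homTo M X)) :
    modK M.FullSubcategoryᵒᵖ n (homTo M K) := by
  obtain ⟨x, hx⟩ := exists_isUniversal_homTo h.mem
  have := h.exact.mono
  refine hX.kernel (homToMap M κ) (homToMap M p) hx.isGenerator.isFinGen hx.projective
    (fun a f g hfg => ?_) (fun a => h.lift _ a.unop.property) fun a f => ⟨?_, ?_⟩
  · exact (cancel_mono κ).1 hfg
  · exact fun hf => h.exact.exists_lift f hf
  · rintro ⟨g, rfl⟩
    exact (Category.assoc _ _ _).trans ((congrArg _ h.exact.zero).trans comp_zero)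

lemma modK_homFrom_cokernel [HasFiniteBiproducts M.FullSubcategory] {n : ℕ} {X N K : C}
    {i : X ⟶ N} {q : N ⟶ K} (h : E.IsLeftApprox M i q)
    (hX : modK M.FullSubcategory (n + 1) (homFrom M X)) :
    modK M.FullSubcategory n (homFrom M K) := by
  obtain ⟨x, hx⟩ := exists_isUniversal_homFrom h.mem
  have := h.exact.epi
  refine hX.kernel (homFromMap M q) (homFromMap M i) hx.isGenerator.isFinGen hx.projective
    (fun a f g hfg => ?_) (fun a => h.extend _ a.property) fun a f => ⟨?_, ?_⟩
  · exact (cancel_epi q).1 hfg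
  · exact fun hf => h.exact.exists_desc f hf
  · rintro ⟨g, rfl⟩
    exact (Category.assoc _ _ _).symm.trans ((congrArg (· ≫ _) h.exact.zero).trans zero_comp)

/-- `M` need not be closed under isomorphism in `C`, so the biproduct is formed inside `M` and its
bicone is carried over to `C`. -/
lemma exists_binaryBicone [HasFiniteBiproducts M.FullSubcategory] (X Y : C) (hX : M X)
    (hY : M Y) :
    ∃ b : BinaryBicone X Y, M b.pt ∧ b.fst ≫ b.inl + b.snd ≫ b.inr = 𝟙 b.pt := by
  have := hasBinaryBiproducts_of_finite_biproducts M.FullSubcategory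
  let B := BinaryBiproduct.bicone (⟨X, hX⟩ : M.FullSubcategory) ⟨Y, hY⟩
  exact ⟨M.ι.mapBinaryBicone B, B.pt.property,
    congrArg (fun f => f.hom) (biprod.total (X := (⟨X, hX⟩ : M.FullSubcategory)) (Y := ⟨Y, hY⟩))⟩

end HomModules

/-! ### The two symmetric inclusions. -/

section Symmetry

open ExactStructure

lemma hasFiniteBiproducts_opposite (A : Type u) [Category.{v} A] [Preadditive A]
    [HasFiniteBiproducts A] : HasFiniteBiproducts Aᵒᵖ := by
  have : HasFiniteCoproducts A := inferInstance
  exact HasFiniteBiproducts.of_hasFiniteProducts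

lemma injectives_le_gen {C : Type u} [Category.{v} C] [Preadditive C]
    [HasFiniteBiproducts C] (E : ExactStructure C) (hP : E.EnoughProjectives)
    (M : ObjectProperty C) [HasFiniteBiproducts M.FullSubcategory] (k : ℕ)
    (hcogen : E.projectives ≤ E.cogen M k)
    (hmod : ∀ I, E.injectives I → modK M.FullSubcategoryᵒᵖ k (homTo M I)) :
    E.injectives ≤ E.gen M k := by
  have := hasBinaryBiproducts_of_finite_biproducts C
  have := hasFiniteBiproducts_opposite M.FullSubcategory
  intro I hI
  refine gen_iff_isGen.2 (isGen_of_factorsThrough hP exists_binaryBicone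
    (fun n X => modK M.FullSubcategoryᵒᵖ n (homTo M X))
    (fun n X h => exists_rightApprox_of_isFinGen h.isFinGen)
    (fun n K N X κ p h hX => modK_homTo_kernel h hX) k 0 ?_ (hI.factorsThrough 0) (hmod I hI))
  rw [Nat.zero_add]
  exact fun P h => cogen_iff_isCogen.1 (hcogen P h)

lemma projectives_le_cogen {C : Type u} [Category.{v} C] [Preadditive C]
    [HasFiniteBiproducts C] (E : ExactStructure C) (hI : E.EnoughInjectives)
    (M : ObjectProperty C) [HasFiniteBiproducts M.FullSubcategory] (k : ℕ)
    (hgen : E.injectives ≤ E.gen M k)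
    (hmod : ∀ P, E.projectives P → modK M.FullSubcategory k (homFrom M P)) :
    E.projectives ≤ E.cogen M k := by
  have := hasBinaryBiproducts_of_finite_biproducts C
  intro P hP
  refine cogen_iff_isCogen.2 (IsGen.unop (X := Opposite.op P)
    (isGen_of_factorsThrough (M := M.op) hI.op ?_
      -- Expressing the invariant on `Cᵒᵖ` by left modules over `M` avoids comparing the full
      -- subcategory of `M.op` with the opposite of that of `M`.
      (fun n X => modK M.FullSubcategory n (homFrom M X.unop)) ?_ ?_ k 0 ?_
      (hP.op.factorsThrough 0) (hmod P hP)))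
  · intro X Y hX hY
    obtain ⟨b, hb, htot⟩ := exists_binaryBicone X.unop Y.unop hX hY
    refine ⟨b.op, hb, Quiver.Hom.unop_inj ?_⟩
    exact htot
  · intro n X h
    obtain ⟨N, g, hN, hg⟩ := exists_leftApprox_of_isFinGen h.isFinGen
    refine ⟨Opposite.op N, g.op, hN, fun T hT f => ?_⟩
    obtain ⟨t, ht⟩ := hg T.unop hT f.unop
    exact ⟨t.op, Quiver.Hom.unop_inj ht⟩
  · intro n K N X κ p h hX
    exact modK_homFrom_cokernel h.unop hX
  · rw [Nat.zero_add]
    exact fun I h => (gen_iff_isGen.1 (hgen I.unop (projectives_unop h))).op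
end Symmetry

end SymPrinciple

theorem theorem3 {C : Type u} [Category.{v} C] [Preadditive C] [HasFiniteBiproducts C]
    (E : SymPrinciple.ExactStructure C)
    (hP : E.EnoughProjectives) (hI : E.EnoughInjectives)
    (M : ObjectProperty C) [HasFiniteBiproducts M.FullSubcategory]
    (k : ℕ) (hk : 1 ≤ k) :
    (E.projectives ≤ E.cogen M k ∧
        ∀ I, E.injectives I →
          SymPrinciple.modK M.FullSubcategoryᵒᵖ k (SymPrinciple.homTo M I)) ↔
      (E.injectives ≤ E.gen M k ∧
        ∀ P, E.projectives P →
          SymPrinciple.modK M.FullSubcategory k (SymPrinciple.homFrom M P)) := by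
  constructor
  · rintro ⟨hcogen, hmod⟩
    have hgen := SymPrinciple.injectives_le_gen E hP M k hcogen hmod
    exact ⟨fun I h => hgen I h, fun P h => SymPrinciple.modK_homFrom_of_cogen (hcogen P h)⟩
  · rintro ⟨hgen, hmod⟩
    exact ⟨SymPrinciple.projectives_le_cogen E hI M k hgen hmod,
      fun I h => SymPrinciple.modK_homTo_of_gen (hgen I h)⟩
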